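/- Let $\mathbb G$ be the Engel group in exponential coordinates of the second kind, that is, $\mathbb R^4$ with the group law $$p\cdot q=\big(p_1+q_1,\;p_2+q_2,\;p_3+q_3+p_1q_2,\;p_4+q_4+p_1q_3+\tfrac{p_1^2}{2}q_2\big),$$ for which $X_1=\partial_1$ and $X_2=\partial_2+x_1\partial_3+\frac{x_1^2}{2}\partial_4$ are left-invariant and generate the Lie algebra. Let $d$ be the Carnot–Carathéodory distance: $d(p,q)$ is the infimum of the lengths $\int_0^1\sqrt{u_1^2+u_2^2}\,dt$ of the horizontal curves $\dot\gamma=u_1X_1(\gamma)+u_2X_2(\gamma)$ from $p$ to $q$. An open set $E\subseteq\mathbb R^4$ is called *$X_2$-calibrated* if * $p\in E$ implies $p\exp(tX_1)\in E$ for all $t\in\mathbb R$, and * for every $p\in\mathbb R^4$ there is $T\in[-\infty,+\infty]$ with $\{t\in\mathbb R: p\exp(tX_2)\in E\}=(T,+\infty)$. Let $a\neq0$, $Y=aX_1+X_2$, and let $W=\{p\in\mathbb R^4: p_2=0\}$, a subgroup complementary to $\exp(\mathbb RY)$. We say that $E$ is the *intrinsic upper-graph* in the direction $Y$ of a function $T:W\to\mathbb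 R$ if $$E=\{w\exp(tY): w\in W,\ t>T(w)\},$$ and the *intrinsic graph* of $T$ is $\Gamma_T=\{w\exp(T(w)Y):w\in W\}$. For $\alpha\ge0$ the *intrinsic cone* with vertex $q$ and opening $\alpha$ is $$\mathcal C_\alpha(q)=\{q\,w\exp(tY): w\in W,\ t\in\mathbb R,\ d(e,w)\le\alpha\,d(e,\exp(tY))\},$$ where $e$ is the neutral element. The function $T$ is *intrinsically $L$-Lipschitz* if $\mathcal C_\alpha(p)\cap\Gamma_T=\{p\}$ for all $p\in\Gamma_T$ and all $\alpha\ge0$ with $\alpha L<1$. **Theorem.** For every $a\ne0$ there is a constant $L\ge 0$, depending only on $a$, such that the following holds for every $X_2$-calibrated set $E$. 1. If $E\neq\emptyset$ and $E\neq\mathbb R^4$, then there is exactly one function $T:W\to\mathbb R$ of which $E$ is the intrinsic upper-graph in the direction $aX_1+X_2$. 2. Whenever $E$ is the intrinsic upper-graph in the direction $aX_1+X_2$ of a function $T:W\to\mathbb R$, the function $T$ is intrinsically $L$-Lipschitz (with respect to the Carnot–Carathéodory distance), and $T$ is Hölder-continuous with exponent $\frac13$ for the Euclidean distance on every bounded subset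 of $W$. -/

import Mathlib

open scoped NNReal ENNReal

noncomputable section

/-- The underlying space of the Engel group in exponential coordinates of the second kind:
`ℝ⁴` with its Euclidean distance and topology. The coordinates `p₁, p₂, p₃, p₄` of the
mathematics are `p 0, p 1, p 2, p 3`. -/
abbrev EngelGroup : Type := EuclideanSpace ℝ (Fin 4)

namespace EngelGroup

/-- The Engel group law: the product for which the vector fields
`X₁ = ∂₁`, `X₂ = ∂₂ + x₁ ∂₃ + (x₁² / 2) ∂₄`, `X₃ = ∂₃ + x₁ ∂₄`, `X₄ = ∂₄` are left-invariant. -/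
instance instMul : Mul EngelGroup where
  mul p q := !₂[p 0 + q 0, p 1 + q 1, p 2 + q 2 + p 0 * q 1,
    p 3 + q 3 + p 0 * q 2 + p 0 ^ 2 / 2 * q 1]

/-- The neutral element is the origin. -/
instance instOne : One EngelGroup where
  one := !₂[0, 0, 0, 0]

instance instInv : Inv EngelGroup where
  inv p := !₂[-p 0, -p 1, -p 2 + p 0 * p 1, -p 3 + p 0 * p 2 - p 0 ^ 2 / 2 * p 1]

theorem mul_def (p q : EngelGroup) : p * q = !₂[p 0 + q 0, p 1 + q 1, p 2 + q 2 + p 0 * q 1,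
    p 3 + q 3 + p 0 * q 2 + p 0 ^ 2 / 2 * q 1] := rfl

theorem one_def : (1 : EngelGroup) = !₂[0, 0, 0, 0] := rfl

theorem inv_def (p : EngelGroup) : p⁻¹ =
    !₂[-p 0, -p 1, -p 2 + p 0 * p 1, -p 3 + p 0 * p 2 - p 0 ^ 2 / 2 * p 1] := rfl

instance instGroup : Group EngelGroup :=
  Group.ofLeftAxioms
    (by intro p q r; ext i; fin_cases i <;> simp [mul_def] <;> ring)
    (by intro p; ext i; fin_cases i <;> simp [mul_def, one_def])
    (by intro p; ext i; fin_cases i <;> simp [mul_def, one_def, inv_def] <;> ring)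

/-- The left-invariant horizontal vector field `X₁ = ∂₁`. -/
def X₁ (_p : EngelGroup) : EngelGroup := !₂[1, 0, 0, 0]

/-- The left-invariant horizontal vector field `X₂ = ∂₂ + x₁ ∂₃ + (x₁² / 2) ∂₄`. -/
def X₂ (p : EngelGroup) : EngelGroup := !₂[0, 1, p 0, p 0 ^ 2 / 2]

/-- `hexp a b t = exp (t (a X₁ + b X₂))`, see `hasDerivAt_mul_hexp` and `mul_hexp_zero`:
`t ↦ p * hexp a b t` is the flow line of `a X₁ + b X₂` starting at `p`. -/
def hexp (a b t : ℝ) : EngelGroup :=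
  !₂[a * t, b * t, a * b * t ^ 2 / 2, a ^ 2 * b * t ^ 3 / 6]

theorem mul_hexp_zero (a b : ℝ) (p : EngelGroup) : p * hexp a b 0 = p := by
  ext i; fin_cases i <;> simp [mul_def, hexp]

theorem hasDerivAt_mul_hexp (a b : ℝ) (p : EngelGroup) (t : ℝ) :
    HasDerivAt (fun s => p * hexp a b s)
      (a • X₁ (p * hexp a b t) + b • X₂ (p * hexp a b t)) t := by
  rw [hasDerivAt_iff_hasFDerivAt, ← hasFDerivWithinAt_univ, hasFDerivWithinAt_euclidean]
  have h1 : HasDerivAt (fun s : ℝ => s) 1 t := hasDerivAt_id t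
  intro i
  suffices h : HasDerivAt (fun s => (p * hexp a b s) i)
      ((a • X₁ (p * hexp a b t) + b • X₂ (p * hexp a b t)) i) t by
    refine (h.hasFDerivAt.congr_fderiv ?_).hasFDerivWithinAt
    ext; simp
  fin_cases i
  · simpa [mul_def, hexp, X₁, X₂] using (h1.const_mul a).const_add (p 0)
  · simpa [mul_def, hexp, X₁, X₂] using (h1.const_mul b).const_add (p 1)
  · have h := ((((h1.pow 2).const_mul (a * b)).div_const 2).const_add (p 2)).add
      ((h1.const_mul b).const_mul (p 0))
    refine (h.congr_deriv ?_).congr_of_eventuallyEq (Filter.Eventually.of_forall fun s => ?_)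
    · simp [mul_def, hexp, X₁, X₂]; ring
    · simp [mul_def, hexp]
  · have h := (((((h1.pow 3).const_mul (a ^ 2 * b)).div_const 6).const_add (p 3)).add
      ((((h1.pow 2).const_mul (a * b)).div_const 2).const_mul (p 0))).add
      ((h1.const_mul b).const_mul (p 0 ^ 2 / 2))
    refine (h.congr_deriv ?_).congr_of_eventuallyEq (Filter.Eventually.of_forall fun s => ?_)
    · simp [mul_def, hexp, X₁, X₂]; ring
    · simp [mul_def, hexp]

/-- An open set `E` is `X₂`-calibrated if it is invariant under the flow of `X₁` and every flow
line of `X₂` meets it in an open half-line `(T, +∞)` with `T ∈ [-∞, +∞]`. -/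
structure IsX₂Calibrated (E : Set EngelGroup) : Prop where
  isOpen : IsOpen E
  invariant : ∀ p ∈ E, ∀ t : ℝ, p * hexp 1 0 t ∈ E
  monotone : ∀ p : EngelGroup, ∃ T : EReal,
    {t : ℝ | p * hexp 0 1 t ∈ E} = {t : ℝ | T < (t : EReal)}

/-- The subgroup `W = {p₂ = 0}`; it carries the Euclidean distance of `ℝ⁴`. -/
def W : Subgroup EngelGroup where
  carrier := {p | p 1 = 0}
  mul_mem' := by
    intro p q hp hq
    simp only [Set.mem_ofPred_eq] at hp hq
    simp [mul_def, hp, hq]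
  one_mem' := by simp [one_def]
  inv_mem' := by
    intro p hp
    simp only [Set.mem_ofPred_eq] at hp
    simp [inv_def, hp]

/-- `E` is the intrinsic upper-graph, along the horizontal direction `a X₁ + X₂`, of `T`. -/
def IsUpperGraph (a : ℝ) (E : Set EngelGroup) (T : W → ℝ) : Prop :=
  E = {p | ∃ (w : W) (t : ℝ), T w < t ∧ p = w * hexp a 1 t}

/-- The intrinsic graph, along the horizontal direction `a X₁ + X₂`, of `T`. -/
def intrinsicGraph (a : ℝ) (T : W → ℝ) : Set EngelGroup :=
  {p | ∃ w : W, p = w * hexp a 1 (T w)}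

/-- `γ` is, on `[0, 1]`, an absolutely continuous curve with
`γ' = u₁ X₁(γ) + u₂ X₂(γ)` almost everywhere, where `u₁, u₂` are integrable
(written in integrated form). -/
structure IsHorizontalCurve (γ : ℝ → EngelGroup) (u₁ u₂ : ℝ → ℝ) : Prop where
  continuousOn : ContinuousOn γ (Set.Icc 0 1)
  integrable₁ : IntervalIntegrable u₁ MeasureTheory.volume 0 1
  integrable₂ : IntervalIntegrable u₂ MeasureTheory.volume 0 1
  eq_integral : ∀ t ∈ Set.Icc (0 : ℝ) 1,
    γ t = γ 0 + ∫ s in (0 : ℝ)..t, (u₁ s • X₁ (γ s) + u₂ s • X₂ (γ s))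

/-- The Carnot-Carathéodory distance of the Engel group, for the scalar product on the
horizontal layer that makes `X₁, X₂` orthonormal: the infimum of the lengths of the horizontal
curves from `p` to `q`. -/
def ccDist (p q : EngelGroup) : ℝ≥0∞ :=
  ⨅ (γ : ℝ → EngelGroup) (u₁ : ℝ → ℝ) (u₂ : ℝ → ℝ) (_ : IsHorizontalCurve γ u₁ u₂)
    (_ : γ 0 = p) (_ : γ 1 = q),
    ∫⁻ t in Set.Icc (0 : ℝ) 1, ENNReal.ofReal (Real.sqrt (u₁ t ^ 2 + u₂ t ^ 2))

/-- The intrinsic (two-sided) cone with vertex `q`, axis `exp (ℝ (a X₁ + X₂))`, base `W` and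
opening `α`: the points `q * w * v` with `w ∈ W`, `v = exp (t (a X₁ + X₂))` and
`d(1, w) ≤ α d(1, v)`, where `d` is the Carnot-Carathéodory distance. -/
def intrinsicCone (a : ℝ) (α : ℝ≥0) (q : EngelGroup) : Set EngelGroup :=
  {p | ∃ (w : W) (t : ℝ), ccDist 1 w ≤ α * ccDist 1 (hexp a 1 t) ∧ p = q * (w * hexp a 1 t)}

/-- `T` is intrinsically `L`-Lipschitz along `a X₁ + X₂`: at each point of its intrinsic graph,
every intrinsic cone of opening `α < 1 / L` meets the graph only at its vertex. -/
def IsIntrinsicLipschitz (a : ℝ) (L : ℝ≥0) (T : W → ℝ) : Prop :=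
  ∀ p ∈ intrinsicGraph a T, ∀ α : ℝ≥0, α * L < 1 →
    intrinsicCone a α p ∩ intrinsicGraph a T = {p}

end EngelGroup

end

namespace EngelGroup

open MeasureTheory Filter Topology

/-! Invariance under `X₁` makes `E` a cylinder over the coordinates `(x₂, x₃, x₄)`. Since `x₁` can
be reset freely, monotonicity along `X₂` becomes monotonicity along every vector `(1, s, s² / 2)`.
Hence `E`, and even its closure, is carried into `E` by the interior `{x > 0, y² < 2xz}` of the
convex cone they span (`IsX₂Calibrated.mem_of_prec`).

For `s > 0` the point `exp (sY)` lies in this interior, with `2xz - y² = a² s⁴ / 12`; here `a ≠ 0`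
enters. A factor from `W` that is small at the homogeneous scale of `s` does not change this
(`IsSmall.prec`). So graph points `p` and `p * w * exp (sY)` with such a `w` force `s = 0`
(`eq_zero_of_isSmall`): otherwise one of them, being in the closure of `E`, would push the other
into `E`, which the graph avoids.

The Lipschitz bound follows because the Carnot-Carathéodory distance controls the homogeneous size
of `w`. For the Hölder bound, `w` is linearly controlled by the Euclidean distance, and its worst
coordinate is compared with `|s|³`. Existence holds because each flow line of `Y` eventually enters
the cone of any given point, in both time directions. -/

@[simp] theorem mul_apply_zero (p q : EngelGroup) : (p * q) 0 = p 0 + q 0 := rfl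

@[simp] theorem mul_apply_one (p q : EngelGroup) : (p * q) 1 = p 1 + q 1 := rfl

@[simp] theorem mul_apply_two (p q : EngelGroup) : (p * q) 2 = p 2 + q 2 + p 0 * q 1 := rfl

@[simp] theorem mul_apply_three (p q : EngelGroup) :
    (p * q) 3 = p 3 + q 3 + p 0 * q 2 + p 0 ^ 2 / 2 * q 1 := rfl

@[simp] theorem hexp_apply_zero (a b t : ℝ) : hexp a b t 0 = a * t := rfl

@[simp] theorem hexp_apply_one (a b t : ℝ) : hexp a b t 1 = b * t := rfl

@[simp] theorem hexp_apply_two (a b t : ℝ) : hexp a b t 2 = a * b * t ^ 2 / 2 := rfl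

@[simp] theorem hexp_apply_three (a b t : ℝ) : hexp a b t 3 = a ^ 2 * b * t ^ 3 / 6 := rfl

theorem ext_coords {p q : EngelGroup} (h0 : p 0 = q 0) (h1 : p 1 = q 1) (h2 : p 2 = q 2)
    (h3 : p 3 = q 3) : p = q := by
  ext i; fin_cases i <;> assumption

theorem W.apply_one (w : W) : (w : EngelGroup) 1 = 0 := w.2

/-! ### The cone order and calibrated sets -/

/-- `Prec p q` says that, modulo the `x₁`-coordinate, `q - p` lies in the interior of the convex
cone spanned by the vectors `(1, s, s² / 2)`, that is, by the directions of `X₂`. -/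
def Prec (p q : EngelGroup) : Prop :=
  0 < q 1 - p 1 ∧ (q 2 - p 2) ^ 2 < 2 * (q 1 - p 1) * (q 3 - p 3)

theorem isOpen_setOf_prec (q : EngelGroup) : IsOpen {p | Prec p q} := by
  have h1 : IsOpen {p : EngelGroup | 0 < q 1 - p 1} := isOpen_lt (by fun_prop) (by fun_prop)
  have h2 : IsOpen {p : EngelGroup | (q 2 - p 2) ^ 2 < 2 * (q 1 - p 1) * (q 3 - p 3)} :=
    isOpen_lt (by fun_prop) (by fun_prop)
  exact h1.inter h2

theorem IsX₂Calibrated.mul_hexp_mem {E : Set EngelGroup} (hE : IsX₂Calibrated E)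
    {p : EngelGroup} (hp : p ∈ E) {t : ℝ} (ht : 0 ≤ t) : p * hexp 0 1 t ∈ E := by
  obtain ⟨T, hT⟩ := hE.monotone p
  have hT' : ∀ s : ℝ, p * hexp 0 1 s ∈ E ↔ T < (s : EReal) := Set.ext_iff.1 hT
  have h0 : T < ((0 : ℝ) : EReal) := (hT' 0).1 (by rwa [mul_hexp_zero])
  exact (hT' t).2 (h0.trans_le (by exact_mod_cast ht))

theorem IsX₂Calibrated.mem_of_prec_of_mem {E : Set EngelGroup} (hE : IsX₂Calibrated E)
    {p q : EngelGroup} (hp : p ∈ E) (h : Prec p q) : q ∈ E := by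
  obtain ⟨hx, hz⟩ := h
  set x := q 1 - p 1 with hxd
  set y := q 2 - p 2 with hyd
  set z := q 3 - p 3 with hzd
  -- `(x, y, z)` is the sum of two vectors `(x / 2) (1, s, s² / 2)` with `s = y / x ± r`; the third
  -- coordinate determines `r`. The path moves along `X₂` twice and corrects `x₁` by `X₁` in
  -- between.
  set r := √(2 * x * z - y ^ 2) / x with hr
  have hr2 : r ^ 2 * x ^ 2 = 2 * x * z - y ^ 2 := by
    rw [hr, div_pow, Real.sq_sqrt (by linarith)]
    field_simp
  have h1 := hE.mul_hexp_mem (hE.invariant p hp (y / x + r - p 0)) (half_pos hx).le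
  have h2 := hE.mul_hexp_mem (hE.invariant _ h1 (-2 * r)) (half_pos hx).le
  have h3 := hE.invariant _ h2 (q 0 - (y / x - r))
  have hs : y / x * x = y := div_mul_cancel₀ _ hx.ne'
  convert h3 using 1
  refine ext_coords ?_ ?_ ?_ ?_
  · simp; ring
  · simp; linarith
  · simp
    linear_combination hyd - hs
  · simp
    have key : x * z = x * (((y / x) ^ 2 + r ^ 2) * x / 2) := by
      linear_combination (-1 / 2 : ℝ) * hr2 - (1 / 2 : ℝ) * (y / x * x + y) * hs
    have key' := mul_left_cancel₀ hx.ne' key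
    linear_combination hzd + key'

/-- `Prec · q` is an open condition, so a point of the closure can be replaced by a nearby point of
`E`. -/
theorem IsX₂Calibrated.mem_of_prec {E : Set EngelGroup} (hE : IsX₂Calibrated E)
    {p q : EngelGroup} (hp : p ∈ closure E) (h : Prec p q) : q ∈ E := by
  obtain ⟨p', h', hp'⟩ := mem_closure_iff.1 hp _ (isOpen_setOf_prec q) h
  exact hE.mem_of_prec_of_mem hp' h'

/-! ### Stability of the cone under perturbation by `W` -/

/-- `g` is close to the neutral element compared with `exp (s (a X₁ + X₂))`, in the homogeneous
sense and up to the factor `δ`. -/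
structure IsSmall (δ s : ℝ) (g : EngelGroup) : Prop where
  zero : |g 0| ≤ δ * |s|
  two : |g 2| ≤ δ * |s| ^ 2
  three : |g 3| ≤ δ * |s| ^ 3

/-- The factor up to which `W`-perturbations do not affect the direction of `a X₁ + X₂`. -/
noncomputable def smallness (a : ℝ) : ℝ := min 1 (a ^ 2 / (12 * (6 + |a|)))

theorem smallness_pos {a : ℝ} (ha : a ≠ 0) : 0 < smallness a := by
  unfold smallness; positivity

theorem smallness_le_one (a : ℝ) : smallness a ≤ 1 := min_le_left _ _

theorem smallness_mul_lt {a : ℝ} (ha : a ≠ 0) : smallness a * (5 + |a|) < a ^ 2 / 12 := by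
  have h : smallness a * (12 * (6 + |a|)) ≤ a ^ 2 :=
    (le_div_iff₀ (by positivity)).1 (min_le_right _ _)
  have := smallness_pos ha
  linarith

/-- The expression is `2xz - y²` for `g * exp (s (a X₁ + X₂))` with `g ∈ W`. The four error terms
cost `2δ + δ + 2δ + |a|δ` times `|s|⁴`, whence the factor `5 + |a|`. -/
theorem IsSmall.discriminant_pos {a s : ℝ} (ha : a ≠ 0) (hs : s ≠ 0) {g : EngelGroup}
    (hg : IsSmall (smallness a) s g) :
    0 < a ^ 2 * s ^ 4 / 12 + 2 * s * g 3 - g 2 ^ 2 - 2 * g 2 * g 0 * s - a * g 2 * s ^ 2 := by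
  set δ := smallness a
  have hδ := smallness_pos ha
  have hδ1 := smallness_le_one a
  have hs' : 0 < |s| := abs_pos.2 hs
  have e4 : s ^ 4 = |s| ^ 4 := by rw [← abs_pow]; exact (abs_of_nonneg (by positivity)).symm
  have hδ2 : δ * δ ≤ δ := mul_le_of_le_one_left hδ.le hδ1
  have b1 : |2 * s * g 3| ≤ 2 * δ * |s| ^ 4 := by
    calc |2 * s * g 3| = 2 * |s| * |g 3| := by simp [abs_mul]
      _ ≤ 2 * |s| * (δ * |s| ^ 3) := by gcongr; exact hg.three
      _ = _ := by ring
  have b2 : |g 2 ^ 2| ≤ δ * |s| ^ 4 := by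
    calc |g 2 ^ 2| = |g 2| * |g 2| := by rw [abs_pow, sq]
      _ ≤ (δ * |s| ^ 2) * (δ * |s| ^ 2) := by gcongr <;> exact hg.two
      _ = δ * δ * |s| ^ 4 := by ring
      _ ≤ _ := by gcongr
  have b3 : |2 * g 2 * g 0 * s| ≤ 2 * δ * |s| ^ 4 := by
    calc |2 * g 2 * g 0 * s| = 2 * |g 2| * |g 0| * |s| := by simp [abs_mul]
      _ ≤ 2 * (δ * |s| ^ 2) * (δ * |s|) * |s| := by
        gcongr
        · exact hg.two
        · exact hg.zero
      _ = 2 * (δ * δ) * |s| ^ 4 := by ring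
      _ ≤ _ := by gcongr
  have b4 : |a * g 2 * s ^ 2| ≤ |a| * δ * |s| ^ 4 := by
    calc |a * g 2 * s ^ 2| = |a| * |g 2| * |s| ^ 2 := by simp [abs_mul]
      _ ≤ |a| * (δ * |s| ^ 2) * |s| ^ 2 := by gcongr; exact hg.two
      _ = _ := by ring
  have hm : 0 < |s| ^ 4 * (a ^ 2 / 12 - δ * (5 + |a|)) :=
    mul_pos (by positivity) (sub_pos.2 (smallness_mul_lt ha))
  rw [e4]
  have := neg_abs_le (2 * s * g 3)
  have := le_abs_self (g 2 ^ 2)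
  have := le_abs_self (2 * g 2 * g 0 * s)
  have := le_abs_self (a * g 2 * s ^ 2)
  linarith

/-- Left translation by `p` shears `(x, y, z)` and preserves `2xz - y²`, so `p` drops out of the
inequality. -/
theorem IsSmall.prec {a s : ℝ} (ha : a ≠ 0) (hs : 0 < s) {w : W}
    (hg : IsSmall (smallness a) s w) (p : EngelGroup) : Prec p (p * (w * hexp a 1 s)) := by
  have h := hg.discriminant_pos ha hs.ne'
  refine ⟨by simpa [W.apply_one] using hs, ?_⟩
  simp [W.apply_one]
  linarith

theorem IsSmall.prec_of_neg {a s : ℝ} (ha : a ≠ 0) (hs : s < 0) {w : W}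
    (hg : IsSmall (smallness a) s w) (p : EngelGroup) : Prec (p * (w * hexp a 1 s)) p := by
  have h := hg.discriminant_pos ha hs.ne
  refine ⟨by simpa [W.apply_one] using hs, ?_⟩
  simp [W.apply_one]
  linarith

theorem isSmall_one {a : ℝ} (ha : a ≠ 0) (s : ℝ) : IsSmall (smallness a) s (1 : W) := by
  have := smallness_pos ha
  constructor <;> simp [one_def] <;> positivity

/-! ### Comparison of flow lines and uniqueness of the graph function -/

/-- The element `g` of `W` with `w' exp ((t + s) Y) = w exp (t Y) g exp (s Y)`, `Y = a X₁ + X₂`. -/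
noncomputable def shift (a t : ℝ) (w w' : W) : W :=
  ⟨!₂[(w' : EngelGroup) 0 - (w : EngelGroup) 0, 0,
    (w' : EngelGroup) 2 - (w : EngelGroup) 2 + ((w' : EngelGroup) 0 - (w : EngelGroup) 0) * t,
    ((w' : EngelGroup) 3 - (w : EngelGroup) 3)
      - ((w : EngelGroup) 0 + a * t) * ((w' : EngelGroup) 2 - (w : EngelGroup) 2)
      + ((w' : EngelGroup) 0 - (w : EngelGroup) 0) *
        (((w' : EngelGroup) 0 - (w : EngelGroup) 0) * t / 2
          - a * t ^ 2 / 2)], rfl⟩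

theorem mul_hexp_eq_mul_shift (a t s : ℝ) (w w' : W) :
    (w' : EngelGroup) * hexp a 1 (t + s) = w * hexp a 1 t * (shift a t w w' * hexp a 1 s) := by
  refine ext_coords ?_ ?_ ?_ ?_ <;> simp [shift, W.apply_one] <;> ring

theorem eq_mul_hexp (a : ℝ) (p : EngelGroup) :
    ∃ w : W, p = w * hexp a 1 (p 1) := by
  refine ⟨⟨p * hexp a 1 (-p 1), ?_⟩, ?_⟩
  · change (p * hexp a 1 (-p 1)) 1 = 0
    simp
  · refine ext_coords ?_ ?_ ?_ ?_ <;> simp <;> ring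

theorem mul_hexp_inj {a : ℝ} {w w' : W} {t t' : ℝ}
    (h : (w : EngelGroup) * hexp a 1 t = w' * hexp a 1 t') : w = w' ∧ t = t' := by
  have ht : t = t' := by
    simpa [W.apply_one] using congrArg (fun p : EngelGroup => p 1) h
  subst ht
  exact ⟨Subtype.ext (mul_right_cancel h), rfl⟩

theorem IsUpperGraph.mem_iff {a : ℝ} {E : Set EngelGroup} {T : W → ℝ} (h : IsUpperGraph a E T)
    (w : W) (t : ℝ) : (w : EngelGroup) * hexp a 1 t ∈ E ↔ T w < t := by
  constructor
  · intro hp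
    rw [h] at hp
    obtain ⟨w', t', ht, he⟩ := hp
    obtain ⟨rfl, rfl⟩ := mul_hexp_inj he
    exact ht
  · intro ht
    rw [h]
    exact ⟨w, t, ht, rfl⟩

theorem IsUpperGraph.unique {a : ℝ} {E : Set EngelGroup} {T T' : W → ℝ} (h : IsUpperGraph a E T)
    (h' : IsUpperGraph a E T') : T = T' := by
  funext w
  exact eq_of_forall_gt_iff fun t => (h.mem_iff w t).symm.trans (h'.mem_iff w t)

theorem IsUpperGraph.notMem {a : ℝ} {E : Set EngelGroup} {T : W → ℝ} (h : IsUpperGraph a E T)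
    (w : W) : (w : EngelGroup) * hexp a 1 (T w) ∉ E := fun hp =>
  lt_irrefl _ ((h.mem_iff w _).1 hp)

theorem IsUpperGraph.mem_closure {a : ℝ} {E : Set EngelGroup} {T : W → ℝ}
    (h : IsUpperGraph a E T) (w : W) : (w : EngelGroup) * hexp a 1 (T w) ∈ closure E := by
  have hc : Tendsto (fun t => (w : EngelGroup) * hexp a 1 t) (𝓝[>] (T w))
      (𝓝 ((w : EngelGroup) * hexp a 1 (T w))) :=
    tendsto_nhdsWithin_of_tendsto_nhds (hasDerivAt_mul_hexp a 1 w (T w)).continuousAt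
  exact mem_closure_of_tendsto hc
    (eventually_nhdsWithin_of_forall fun t ht => (h.mem_iff w t).2 ht)

theorem not_prec_of_mem_intrinsicGraph {a : ℝ} {E : Set EngelGroup} {T : W → ℝ}
    (hE : IsX₂Calibrated E) (h : IsUpperGraph a E T) {p q : EngelGroup}
    (hp : p ∈ intrinsicGraph a T) (hq : q ∈ intrinsicGraph a T) : ¬ Prec p q := by
  obtain ⟨w, rfl⟩ := hp
  obtain ⟨w', rfl⟩ := hq
  exact fun hpq => h.notMem w' (hE.mem_of_prec (h.mem_closure w) hpq)

/-- Two points of the intrinsic graph are not separated by a small element of `W`. -/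
theorem eq_zero_of_isSmall {a : ℝ} (ha : a ≠ 0) {E : Set EngelGroup} {T : W → ℝ}
    (hE : IsX₂Calibrated E) (h : IsUpperGraph a E T) {p : EngelGroup} {w : W} {s : ℝ}
    (hp : p ∈ intrinsicGraph a T) (hq : p * (w * hexp a 1 s) ∈ intrinsicGraph a T)
    (hw : IsSmall (smallness a) s w) : s = 0 := by
  rcases lt_trichotomy s 0 with hs | hs | hs
  · exact (not_prec_of_mem_intrinsicGraph hE h hq hp (hw.prec_of_neg ha hs p)).elim
  · exact hs
  · exact (not_prec_of_mem_intrinsicGraph hE h hp hq (hw.prec ha hs p)).elim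

theorem abs_coord_sub_le_dist (w w' : W) (i : Fin 4) :
    |(w' : EngelGroup) i - (w : EngelGroup) i| ≤ dist w w' := by
  have := PiLp.norm_apply_le ((w' : EngelGroup) - (w : EngelGroup)) i
  rw [dist_comm, Subtype.dist_eq, dist_eq_norm]
  simpa using this

/-- The coordinates of `shift` are polynomials vanishing at `w' = w`, hence linearly bounded on
bounded sets. -/
theorem exists_bound_shift (a R M : ℝ) : ∃ C > 0, ∀ (t : ℝ) (w w' : W), |t| ≤ M →
    |(w : EngelGroup) 0| ≤ R → dist w w' ≤ R →
    ∀ i, |(shift a t w w' : EngelGroup) i| ≤ C * dist w w' := by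
  have hpos : ∀ R M : ℝ, 0 ≤ R → 0 ≤ M →
      ∀ (t : ℝ) (w w' : W), |t| ≤ M → |(w : EngelGroup) 0| ≤ R → dist w w' ≤ R →
    ∀ i, |(shift a t w w' : EngelGroup) i| ≤
      (1 + M + (R + |a| * M) + (R * M / 2 + |a| * M ^ 2 / 2)) * dist w w' := by
    intro R M hR hM t w w' ht hw hd i
    set η := dist w w'
    have hη : 0 ≤ η := dist_nonneg
    have d0 := abs_coord_sub_le_dist w w' 0
    have d2 := abs_coord_sub_le_dist w w' 2
    have d3 := abs_coord_sub_le_dist w w' 3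
    have hRM := mul_nonneg hR hM
    have haM : 0 ≤ |a| * M := by positivity
    have haM2 : 0 ≤ |a| * M ^ 2 := by positivity
    set x := (w' : EngelGroup) 0 - (w : EngelGroup) 0
    set y := (w' : EngelGroup) 2 - (w : EngelGroup) 2
    set z := (w' : EngelGroup) 3 - (w : EngelGroup) 3
    have hxt : |x * t| ≤ η * M := by rw [abs_mul]; gcongr
    have hu : |((w : EngelGroup) 0 + a * t) * y| ≤ (R + |a| * M) * η := by
      rw [abs_mul]
      gcongr
      refine (abs_add_le _ _).trans ?_
      rw [abs_mul]
      gcongr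
    have hv : |x * (x * t / 2 - a * t ^ 2 / 2)| ≤ η * (R * M / 2 + |a| * M ^ 2 / 2) := by
      rw [abs_mul]
      gcongr
      refine (abs_sub _ _).trans ?_
      simp only [abs_mul, abs_div, abs_pow, abs_two]
      gcongr
      exact d0.trans hd
    fin_cases i
    · change |x| ≤ _
      nlinarith
    · change |(0 : ℝ)| ≤ _
      rw [abs_zero]; positivity
    · change |y + x * t| ≤ _
      have := abs_add_le y (x * t)
      nlinarith
    · change |z - ((w : EngelGroup) 0 + a * t) * y + x * (x * t / 2 - a * t ^ 2 / 2)| ≤ _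
      have := abs_add_le (z - ((w : EngelGroup) 0 + a * t) * y) (x * (x * t / 2 - a * t ^ 2 / 2))
      have := abs_sub z (((w : EngelGroup) 0 + a * t) * y)
      nlinarith
  refine ⟨1 + |M| + (|R| + |a| * |M|) + (|R| * |M| / 2 + |a| * |M| ^ 2 / 2), by positivity, ?_⟩
  intro t w w' ht hw hd
  exact hpos |R| |M| (abs_nonneg _) (abs_nonneg _) t w w' (ht.trans (le_abs_self _))
    (hw.trans (le_abs_self _)) (hd.trans (le_abs_self _))

/-- Flow lines through a bounded part of `W` pass a given point within a bounded time. -/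
theorem exists_time_prec {a : ℝ} (ha : a ≠ 0) (p : EngelGroup) (R : ℝ) : ∃ M : ℝ,
    ∀ w : W, dist w 1 ≤ R → ∀ t, M ≤ t →
      Prec p (w * hexp a 1 t) ∧ Prec (w * hexp a 1 (-t)) p := by
  obtain ⟨v, hv⟩ := eq_mul_hexp a p
  have hδ := smallness_pos ha
  -- The maximum bounds both `|v 0|` and `dist v w`, as `exists_bound_shift` uses one radius for
  -- both.
  obtain ⟨C, hC, hb⟩ := exists_bound_shift a (max |(v : EngelGroup) 0| (dist v 1 + R)) |p 1|
  set D := C * max |(v : EngelGroup) 0| (dist v 1 + R) with hD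
  have hsmall : ∀ w : W, dist w 1 ≤ R → ∀ s : ℝ, 1 ≤ |s| → D / smallness a ≤ |s| →
      IsSmall (smallness a) s (shift a (p 1) v w) := by
    intro w hw s h1 h2
    have hvw : dist v w ≤ max |(v : EngelGroup) 0| (dist v 1 + R) :=
      ((dist_triangle_right v w 1).trans (by gcongr)).trans (le_max_right _ _)
    have hc : ∀ i, |(shift a (p 1) v w : EngelGroup) i| ≤ smallness a * |s| := fun i =>
      (hb (p 1) v w le_rfl (le_max_left _ _) hvw i).trans <|
        (mul_le_mul_of_nonneg_left hvw hC.le).trans <| by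
          exact (div_le_iff₀' hδ).1 h2
    refine ⟨hc 0, (hc 2).trans ?_, (hc 3).trans ?_⟩ <;> gcongr
    · exact le_self_pow₀ h1 (by norm_num)
    · exact le_self_pow₀ h1 (by norm_num)
  refine ⟨|p 1| + max 1 (D / smallness a), fun w hw t ht => ?_⟩
  have h1 := le_max_left 1 (D / smallness a)
  have h2 := le_max_right 1 (D / smallness a)
  have h3 := le_abs_self (p 1)
  have h4 := neg_abs_le (p 1)
  constructor
  · have hs : 0 < t - p 1 := by linarith
    have := (hsmall w hw (t - p 1) (by rw [abs_of_pos hs]; linarith)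
      (by rw [abs_of_pos hs]; linarith)).prec ha hs p
    have e := mul_hexp_eq_mul_shift a (p 1) (t - p 1) v w
    rw [← hv, add_sub_cancel] at e
    rwa [e]
  · have hs : -t - p 1 < 0 := by linarith
    have := (hsmall w hw (-t - p 1) (by rw [abs_of_neg hs]; linarith)
      (by rw [abs_of_neg hs]; linarith)).prec_of_neg ha hs p
    have e := mul_hexp_eq_mul_shift a (p 1) (-t - p 1) v w
    rw [← hv, add_sub_cancel] at e
    rwa [e]

/-! ### Existence, local boundedness and Hölder continuity -/

theorem exists_isUpperGraph {a : ℝ} (ha : a ≠ 0) {E : Set EngelGroup} (hE : IsX₂Calibrated E)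
    (hne : E.Nonempty) (huniv : E ≠ Set.univ) : ∃ T : W → ℝ, IsUpperGraph a E T := by
  obtain ⟨e, he⟩ := hne
  obtain ⟨f, hf⟩ := (Set.ne_univ_iff_exists_notMem E).1 huniv
  let S : W → Set ℝ := fun w => {t | (w : EngelGroup) * hexp a 1 t ∈ E}
  have hmono : ∀ w : W, ∀ t ∈ S w, ∀ t', t < t' → t' ∈ S w := by
    intro w t ht t' htt'
    have h := (isSmall_one ha (t' - t)).prec ha (sub_pos.2 htt') ((w : EngelGroup) * hexp a 1 t)
    have e : (w : EngelGroup) * hexp a 1 t * ((1 : W) * hexp a 1 (t' - t)) = w * hexp a 1 t' := by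
      refine ext_coords ?_ ?_ ?_ ?_ <;> simp [W.apply_one] <;> ring
    rw [e] at h
    exact hE.mem_of_prec_of_mem ht h
  have hSne : ∀ w, (S w).Nonempty := fun w => by
    obtain ⟨M, hM⟩ := exists_time_prec ha e (dist w 1)
    exact ⟨M, hE.mem_of_prec_of_mem he (hM w le_rfl M le_rfl).1⟩
  have hSbdd : ∀ w, BddBelow (S w) := fun w => by
    obtain ⟨M, hM⟩ := exists_time_prec ha f (dist w 1)
    refine ⟨-M, fun t ht => ?_⟩
    by_contra! hlt
    have := (hM w le_rfl (-t) (by linarith)).2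
    rw [neg_neg] at this
    exact hf (hE.mem_of_prec_of_mem ht this)
  have hSopen : ∀ w, IsOpen (S w) := fun w => hE.isOpen.preimage <|
    continuous_iff_continuousAt.2 fun t => (hasDerivAt_mul_hexp a 1 w t).continuousAt
  -- Each `S w` is an open, upward closed, nonempty set bounded below, hence an open half-line.
  have hS : ∀ w t, t ∈ S w ↔ sInf (S w) < t := by
    intro w t
    constructor
    · intro ht
      have hmem : S w ∈ 𝓝[<] t := mem_nhdsWithin_of_mem_nhds ((hSopen w).mem_nhds ht)
      obtain ⟨t', ht', hlt⟩ := Filter.nonempty_of_mem (inter_mem hmem self_mem_nhdsWithin)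
      exact (csInf_le (hSbdd w) ht').trans_lt hlt
    · intro ht
      obtain ⟨t', ht', hlt⟩ := exists_lt_of_csInf_lt (hSne w) ht
      exact hmono w t' ht' t hlt
  refine ⟨fun w => sInf (S w), Set.ext fun p => ⟨fun hp => ?_, ?_⟩⟩
  · obtain ⟨w, hw⟩ := eq_mul_hexp a p
    exact ⟨w, p 1, (hS w _).1 (show (w : EngelGroup) * hexp a 1 (p 1) ∈ E by rwa [← hw]), hw⟩
  · rintro ⟨w, t, ht, rfl⟩
    exact (hS w t).2 ht

/-- Every graph point is compared with the one over `1`, which lies in the closure of `E` but not in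
`E`. -/
theorem IsUpperGraph.exists_bound {a : ℝ} (ha : a ≠ 0) {E : Set EngelGroup} {T : W → ℝ}
    (hE : IsX₂Calibrated E) (h : IsUpperGraph a E T) (R : ℝ) :
    ∃ M : ℝ, ∀ w : W, dist w 1 ≤ R → |T w| ≤ M := by
  have hp := h.mem_closure 1
  have hq := h.notMem 1
  obtain ⟨M, hM⟩ := exists_time_prec ha (((1 : W) : EngelGroup) * hexp a 1 (T 1)) R
  refine ⟨M, fun w hw => abs_le.2 ⟨?_, ?_⟩⟩
  · by_contra! hlt
    have := (hM w hw (-T w) (by linarith)).2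
    rw [neg_neg] at this
    exact hq (hE.mem_of_prec (h.mem_closure w) this)
  · exact ((h.mem_iff w M).1 (hE.mem_of_prec hp (hM w hw M le_rfl).1)).le

theorem IsUpperGraph.holderOnWith {a : ℝ} (ha : a ≠ 0) {E : Set EngelGroup} {T : W → ℝ}
    (hE : IsX₂Calibrated E) (h : IsUpperGraph a E T) {B : Set W} (hB : Bornology.IsBounded B) :
    ∃ H : ℝ≥0, HolderOnWith H (1 / 3) T B := by
  obtain ⟨R, hR⟩ := hB.subset_closedBall 1
  obtain ⟨M, hM⟩ := h.exists_bound ha hE R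
  obtain ⟨C, hC, hb⟩ := exists_bound_shift a (2 * R) M
  have hδ := smallness_pos ha
  set δ := smallness a
  -- Since `|s| ≤ 2M`, the factor `(1 + 2M)²` lets a bound by `|s|³` serve also for the weights
  -- `|s|` and `|s|²`.
  set A := C * (1 + 2 * M) ^ 2 / δ + 1 with hA
  have key : ∀ w ∈ B, ∀ w' ∈ B, |T w' - T w| ^ 3 ≤ A * dist w w' := by
    intro w hw w' hw'
    have r : dist w 1 ≤ R := hR hw
    have r' : dist w' 1 ≤ R := hR hw'
    have m := hM w r
    have m' := hM w' r'
    have hM0 : 0 ≤ M := (abs_nonneg _).trans m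
    have hA0 : 0 < A := by positivity
    set s := T w' - T w with hs
    by_contra! hlt
    have hsM : |s| ≤ 2 * M := (abs_sub _ _).trans (by linarith)
    have hw0 : |(w : EngelGroup) 0| ≤ 2 * R := by
      have := abs_coord_sub_le_dist 1 w 0
      rw [dist_comm] at this
      have hz : ((1 : W) : EngelGroup) 0 = 0 := rfl
      rw [hz, sub_zero] at this
      linarith [dist_nonneg (x := w) (y := 1)]
    have hd : dist w w' ≤ 2 * R := (dist_triangle_right w w' 1).trans (by linarith)
    have hg : ∀ i, |(shift a (T w) w w' : EngelGroup) i| * (1 + 2 * M) ^ 2 ≤ δ * |s| ^ 3 := by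
      intro i
      calc _ ≤ C * dist w w' * (1 + 2 * M) ^ 2 := by gcongr; exact hb _ w w' m hw0 hd i
        _ = δ * ((A - 1) * dist w w') := by rw [hA]; field_simp; ring
        _ ≤ δ * (A * dist w w') := by gcongr; linarith
        _ ≤ _ := by gcongr
    have hsmall : IsSmall δ s (shift a (T w) w w') := by
      have h0 := hg 0
      have h2 := hg 2
      have h3 := hg 3
      have hs0 := abs_nonneg s
      refine ⟨?_, ?_, ?_⟩
      · refine le_of_mul_le_mul_right (h0.trans ?_) (by positivity : 0 < (1 + 2 * M) ^ 2)
        calc δ * |s| ^ 3 = δ * |s| * |s| ^ 2 := by ring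
          _ ≤ _ := by gcongr; linarith
      · refine le_of_mul_le_mul_right (h2.trans ?_) (by positivity : 0 < (1 + 2 * M) ^ 2)
        calc δ * |s| ^ 3 = δ * |s| ^ 2 * |s| := by ring
          _ ≤ _ := by gcongr; nlinarith
      · refine le_trans (le_mul_of_one_le_right (abs_nonneg _) ?_) h3
        nlinarith
    have e := mul_hexp_eq_mul_shift a (T w) s w w'
    rw [hs, add_sub_cancel, ← hs] at e
    have h0 := eq_zero_of_isSmall ha hE h (p := (w : EngelGroup) * hexp a 1 (T w)) ⟨w, rfl⟩
      (by rw [← e]; exact ⟨w', rfl⟩) hsmall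
    rw [h0] at hlt
    have : 0 ≤ A * dist w w' := by positivity
    simp at hlt
    linarith
  by_cases hBe : B.Nonempty
  swap
  · rw [Set.not_nonempty_iff_eq_empty.1 hBe]
    exact ⟨0, by simp [HolderOnWith]⟩
  obtain ⟨b, hbB⟩ := hBe
  have hA0 : 0 ≤ A := by positivity
  refine ⟨Real.toNNReal (A ^ (1 / 3 : ℝ)), fun w hw w' hw' => ?_⟩
  have h3 := key w hw w' hw'
  have hroot : |T w' - T w| ≤ A ^ (1 / 3 : ℝ) * dist w w' ^ (1 / 3 : ℝ) := by
    rw [← Real.mul_rpow hA0 dist_nonneg]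
    have := Real.rpow_le_rpow (by positivity) h3 (by norm_num : (0 : ℝ) ≤ 1 / 3)
    rwa [← Real.rpow_natCast, ← Real.rpow_mul (abs_nonneg _), show ((3 : ℕ) : ℝ) * (1 / 3) = 1 by
      norm_num, Real.rpow_one] at this
  rw [edist_dist, edist_dist, Real.dist_eq, abs_sub_comm,
    ENNReal.ofReal_rpow_of_nonneg dist_nonneg (by positivity)]
  change _ ≤ ENNReal.ofReal _ * _
  rw [← ENNReal.ofReal_mul (by positivity)]
  refine ENNReal.ofReal_le_ofReal ?_
  simpa using hroot

/-! ### Horizontal curves and the Carnot-Carathéodory distance -/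

theorem continuous_X₁ : Continuous X₁ := continuous_const

theorem continuous_X₂ : Continuous X₂ := by
  unfold X₂
  fun_prop

section Horizontal

variable {γ : ℝ → EngelGroup} {u₁ u₂ : ℝ → ℝ}

theorem IsHorizontalCurve.apply_eq (h : IsHorizontalCurve γ u₁ u₂) {t : ℝ}
    (ht : t ∈ Set.Icc (0 : ℝ) 1) (i : Fin 4) :
    γ t i = γ 0 i + ∫ s in (0 : ℝ)..t, (u₁ s * X₁ (γ s) i + u₂ s * X₂ (γ s) i) := by
  have hsub : Set.uIcc (0 : ℝ) t ⊆ Set.Icc 0 1 := by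
    rw [Set.uIcc_of_le ht.1]; exact Set.Icc_subset_Icc_right ht.2
  have hsub' : Set.uIcc (0 : ℝ) t ⊆ Set.uIcc 0 1 := by
    rwa [Set.uIcc_of_le (zero_le_one' ℝ)]
  have hi : IntervalIntegrable (fun s => u₁ s • X₁ (γ s) + u₂ s • X₂ (γ s)) volume 0 t :=
    ((h.integrable₁.mono_set hsub').smul_continuousOn
      (continuous_X₁.comp_continuousOn (h.continuousOn.mono hsub))).add
    ((h.integrable₂.mono_set hsub').smul_continuousOn
      (continuous_X₂.comp_continuousOn (h.continuousOn.mono hsub)))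
  have := (EuclideanSpace.proj (𝕜 := ℝ) i).intervalIntegral_comp_comm hi
  rw [h.eq_integral t ht]
  simpa using this.symm

theorem abs_integral_le_of_length_le (h : IsHorizontalCurve γ u₁ u₂) {ℓ : ℝ}
    (hℓ : ∫⁻ t in Set.Icc (0 : ℝ) 1, ENNReal.ofReal (√(u₁ t ^ 2 + u₂ t ^ 2)) ≤ ENNReal.ofReal ℓ)
    (hℓ0 : 0 ≤ ℓ) {f : ℝ → ℝ} {c : ℝ} (hc : 0 ≤ c)
    (hf : ∀ s ∈ Set.Icc (0 : ℝ) 1, |f s| ≤ c * √(u₁ s ^ 2 + u₂ s ^ 2))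
    {t : ℝ} (ht : t ∈ Set.Icc (0 : ℝ) 1) : |∫ s in (0 : ℝ)..t, f s| ≤ c * ℓ := by
  have hm : AEStronglyMeasurable (fun s => √(u₁ s ^ 2 + u₂ s ^ 2))
      (volume.restrict (Set.Ioc (0 : ℝ) 1)) := by
    have h1 := h.integrable₁.1.aestronglyMeasurable
    have h2 := h.integrable₂.1.aestronglyMeasurable
    exact Real.continuous_sqrt.comp_aestronglyMeasurable ((h1.pow 2).add (h2.pow 2))
  rw [← restrict_Ioc_eq_restrict_Icc] at hℓ
  have hint : IntegrableOn (fun s => √(u₁ s ^ 2 + u₂ s ^ 2)) (Set.Ioc (0 : ℝ) 1) := by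
    refine ⟨hm, ?_⟩
    rw [hasFiniteIntegral_iff_ofReal (ae_of_all _ fun _ => Real.sqrt_nonneg _)]
    exact hℓ.trans_lt ENNReal.ofReal_lt_top
  have hle : ∫ s in Set.Ioc (0 : ℝ) 1, √(u₁ s ^ 2 + u₂ s ^ 2) ≤ ℓ := by
    rw [integral_eq_lintegral_of_nonneg_ae (ae_of_all _ fun _ => Real.sqrt_nonneg _) hm]
    exact ENNReal.toReal_le_of_le_ofReal hℓ0 hℓ
  rw [intervalIntegral.integral_of_le ht.1, ← Real.norm_eq_abs]
  have hst : Set.Ioc (0 : ℝ) t ⊆ Set.Ioc 0 1 := Set.Ioc_subset_Ioc_right ht.2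
  calc ‖∫ s in Set.Ioc (0 : ℝ) t, f s‖
      ≤ ∫ s in Set.Ioc (0 : ℝ) t, c * √(u₁ s ^ 2 + u₂ s ^ 2) := by
        refine norm_integral_le_of_norm_le ((hint.mono_set hst).const_mul c) ?_
        filter_upwards [ae_restrict_mem measurableSet_Ioc] with s hs
        exact hf s (Set.Ioc_subset_Icc_self (hst hs))
    _ ≤ ∫ s in Set.Ioc (0 : ℝ) 1, c * √(u₁ s ^ 2 + u₂ s ^ 2) :=
        setIntegral_mono_set (hint.const_mul c)
          (ae_of_all _ fun _ => mul_nonneg hc (Real.sqrt_nonneg _)) hst.eventuallyLE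
    _ = c * ∫ s in Set.Ioc (0 : ℝ) 1, √(u₁ s ^ 2 + u₂ s ^ 2) := integral_const_mul _ _
    _ ≤ c * ℓ := by gcongr

/-- A horizontal curve of length at most `ℓ` from the neutral element stays in the box of
homogeneous size `ℓ`. -/
theorem IsHorizontalCurve.bounds (h : IsHorizontalCurve γ u₁ u₂) (h0 : γ 0 = 1) {ℓ : ℝ}
    (hℓ : ∫⁻ t in Set.Icc (0 : ℝ) 1, ENNReal.ofReal (√(u₁ t ^ 2 + u₂ t ^ 2)) ≤ ENNReal.ofReal ℓ)
    (hℓ0 : 0 ≤ ℓ) : |γ 1 0| ≤ ℓ ∧ |γ 1 2| ≤ ℓ ^ 2 ∧ |γ 1 3| ≤ ℓ ^ 3 := by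
  have hu₁ : ∀ s, |u₁ s| ≤ √(u₁ s ^ 2 + u₂ s ^ 2) := fun s =>
    Real.abs_le_sqrt (by nlinarith [sq_nonneg (u₂ s)])
  have hu₂ : ∀ s, |u₂ s| ≤ √(u₁ s ^ 2 + u₂ s ^ 2) := fun s =>
    Real.abs_le_sqrt (by nlinarith [sq_nonneg (u₁ s)])
  -- Needed at all times: the other two coordinates are the integrals of `u₂ γ₁` and `u₂ γ₁² / 2`,
  -- where `γ₁` is `γ · 0`.
  have b0 : ∀ t ∈ Set.Icc (0 : ℝ) 1, |γ t 0| ≤ ℓ := by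
    intro t ht
    have e := h.apply_eq ht 0
    simp only [h0, X₁, X₂, one_def] at e
    have := abs_integral_le_of_length_le h hℓ hℓ0 zero_le_one (f := u₁)
      (fun s _ => by simpa using hu₁ s) ht
    simp at e this
    rwa [e]
  have one_mem : (1 : ℝ) ∈ Set.Icc (0 : ℝ) 1 := by simp
  refine ⟨b0 1 one_mem, ?_, ?_⟩
  · have e := h.apply_eq one_mem 2
    simp only [h0, X₁, X₂, one_def] at e
    have := abs_integral_le_of_length_le h hℓ hℓ0 hℓ0 (f := fun s => u₂ s * γ s 0)
      (fun s hs => by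
        rw [abs_mul, mul_comm]
        exact mul_le_mul (b0 s hs) (hu₂ s) (abs_nonneg _) hℓ0) one_mem
    simp at e this
    rw [e]
    linarith
  · have e := h.apply_eq one_mem 3
    simp only [h0, X₁, X₂, one_def] at e
    have := abs_integral_le_of_length_le h hℓ hℓ0 (sq_nonneg ℓ) (f := fun s => u₂ s * (γ s 0 ^ 2 / 2))
      (fun s hs => by
        rw [abs_mul, mul_comm]
        refine mul_le_mul ?_ (hu₂ s) (abs_nonneg _) (sq_nonneg ℓ)
        rw [abs_div, abs_pow, abs_two]
        have := pow_le_pow_left₀ (abs_nonneg _) (b0 s hs) 2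
        linarith [sq_nonneg |γ s 0|]) one_mem
    simp at e this
    rw [e]
    linarith

end Horizontal

theorem coords_le_of_ccDist_le {p : EngelGroup} {ℓ : ℝ} (hℓ0 : 0 ≤ ℓ)
    (h : ccDist 1 p ≤ ENNReal.ofReal ℓ) : |p 0| ≤ ℓ ∧ |p 2| ≤ ℓ ^ 2 ∧ |p 3| ≤ ℓ ^ 3 := by
  -- No minimizing curve is at hand, so the bounds are taken for `m > ℓ` and passed to the limit.
  have key : ∀ m > ℓ, |p 0| ≤ m ∧ |p 2| ≤ m ^ 2 ∧ |p 3| ≤ m ^ 3 := by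
    intro m hm
    have hlt := h.trans_lt ((ENNReal.ofReal_lt_ofReal_iff (hℓ0.trans_lt hm)).2 hm)
    simp only [ccDist, iInf_lt_iff] at hlt
    obtain ⟨γ, u₁, u₂, hγ, h0, h1, hlen⟩ := hlt
    rw [← h1]
    exact hγ.bounds h0 hlen.le (hℓ0.trans hm.le)
  have hev : ∀ᶠ m in 𝓝[>] ℓ, |p 0| ≤ m ∧ |p 2| ≤ m ^ 2 ∧ |p 3| ≤ m ^ 3 :=
    eventually_nhdsWithin_of_forall key
  have hid : Tendsto (fun m : ℝ => m) (𝓝[>] ℓ) (𝓝 ℓ) := tendsto_nhdsWithin_of_tendsto_nhds tendsto_id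
  exact ⟨ge_of_tendsto hid (hev.mono fun _ h => h.1),
    ge_of_tendsto (hid.pow 2) (hev.mono fun _ h => h.2.1),
    ge_of_tendsto (hid.pow 3) (hev.mono fun _ h => h.2.2)⟩

theorem isHorizontalCurve_hexp (a b t : ℝ) :
    IsHorizontalCurve (fun s => hexp a b (t * s)) (fun _ => t * a) (fun _ => t * b) := by
  have hd : ∀ s, HasDerivAt (fun s => hexp a b (t * s))
      ((t * a) • X₁ (hexp a b (t * s)) + (t * b) • X₂ (hexp a b (t * s))) s := by
    intro s
    have := (hasDerivAt_mul_hexp a b 1 (t * s)).scomp s ((hasDerivAt_id s).const_mul t)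
    simpa [Function.comp_def, smul_smul] using this
  have hc : Continuous fun s => hexp a b (t * s) :=
    continuous_iff_continuousAt.2 fun s => (hd s).continuousAt
  refine ⟨hc.continuousOn, by simp, by simp, fun r _ => ?_⟩
  rw [intervalIntegral.integral_eq_sub_of_hasDerivAt (fun s _ => hd s)]
  · simp
  · refine Continuous.intervalIntegrable ?_ _ _
    exact ((continuous_X₁.comp hc).const_smul (t * a)).add
      ((continuous_X₂.comp hc).const_smul (t * b))

theorem ccDist_one_hexp_le (a t : ℝ) :
    ccDist 1 (hexp a 1 t) ≤ ENNReal.ofReal (√(a ^ 2 + 1) * |t|) := by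
  refine (iInf_le_of_le _ <| iInf_le_of_le _ <| iInf_le_of_le _ <|
    iInf_le_of_le (isHorizontalCurve_hexp a 1 t) <| iInf_le_of_le ?_ <| iInf_le_of_le ?_ ?_)
  · refine ext_coords ?_ ?_ ?_ ?_ <;> simp [one_def]
  · simp
  · have : √((t * a) ^ 2 + (t * 1) ^ 2) = √(a ^ 2 + 1) * |t| := by
      rw [← Real.sqrt_sq_eq_abs, ← Real.sqrt_mul (by positivity)]
      ring_nf
    rw [this]
    simp

/-! ### The intrinsic Lipschitz property -/

theorem IsUpperGraph.isIntrinsicLipschitz {a : ℝ} (ha : a ≠ 0) {E : Set EngelGroup} {T : W → ℝ}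
    (hE : IsX₂Calibrated E) (h : IsUpperGraph a E T) :
    IsIntrinsicLipschitz a (Real.toNNReal (√(a ^ 2 + 1) / smallness a)) T := by
  intro p hp α hα
  have hδ := smallness_pos ha
  have hδ1 := smallness_le_one a
  -- The constant is chosen so that the cone condition puts `w` in the box of size `smallness a *
  -- |t|`; as `smallness a ≤ 1`, its powers only help.
  have hα' : α * √(a ^ 2 + 1) < smallness a := by
    have : (α : ℝ) * (√(a ^ 2 + 1) / smallness a) < 1 := by
      have := NNReal.coe_lt_coe.2 hα
      rwa [NNReal.coe_mul, Real.coe_toNNReal _ (by positivity)] at this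
    rwa [← mul_div_assoc, div_lt_one hδ] at this
  have hcc : ∀ t, α * ccDist 1 (hexp a 1 t) ≤ ENNReal.ofReal (α * √(a ^ 2 + 1) * |t|) := by
    intro t
    rw [mul_assoc, ENNReal.ofReal_mul α.coe_nonneg, ENNReal.ofReal_coe_nnreal]
    gcongr
    exact ccDist_one_hexp_le a t
  have hexp_zero : hexp a 1 0 = 1 := by
    refine ext_coords ?_ ?_ ?_ ?_ <;> simp [one_def]
  refine Set.Subset.antisymm ?_ ?_
  · rintro q ⟨⟨w, t, hw, rfl⟩, hq⟩
    obtain ⟨c0, c2, c3⟩ := coords_le_of_ccDist_le (by positivity) (hw.trans (hcc t))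
    have hle : α * √(a ^ 2 + 1) * |t| ≤ smallness a * |t| := by gcongr
    have ht : t = 0 := by
      refine eq_zero_of_isSmall ha hE h hp hq ⟨c0.trans hle, c2.trans ?_, c3.trans ?_⟩
      · refine (pow_le_pow_left₀ (by positivity) hle 2).trans ?_
        rw [mul_pow]
        gcongr
        exact pow_le_of_le_one hδ.le hδ1 (by norm_num)
      · refine (pow_le_pow_left₀ (by positivity) hle 3).trans ?_
        rw [mul_pow]
        gcongr
        exact pow_le_of_le_one hδ.le hδ1 (by norm_num)
    subst ht
    have hw1 : (w : EngelGroup) = 1 := by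
      simp at c0 c2 c3
      exact ext_coords c0 (W.apply_one w) c2 c3
    simp [hw1, hexp_zero]
  · rintro _ rfl
    refine ⟨⟨1, 0, ?_, by simp [hexp_zero]⟩, hp⟩
    have := ccDist_one_hexp_le a 0
    rw [hexp_zero] at this
    simp at this
    simp [this]

end EngelGroup

theorem mainTheorem4 (a : ℝ) (ha : a ≠ 0) :
    ∃ L : ℝ≥0, ∀ E : Set EngelGroup, EngelGroup.IsX₂Calibrated E →
      (E.Nonempty → E ≠ Set.univ →
        ∃! T : EngelGroup.W → ℝ, EngelGroup.IsUpperGraph a E T) ∧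
      ∀ T : EngelGroup.W → ℝ, EngelGroup.IsUpperGraph a E T →
        EngelGroup.IsIntrinsicLipschitz a L T ∧
        ∀ B : Set EngelGroup.W, Bornology.IsBounded B →
          ∃ H : ℝ≥0, HolderOnWith H (1 / 3) T B := by
  refine ⟨_, fun E hE => ⟨fun hne huniv => ?_, fun T h =>
    ⟨h.isIntrinsicLipschitz ha hE, fun B hB => h.holderOnWith ha hE hB⟩⟩⟩
  obtain ⟨T, hT⟩ := EngelGroup.exists_isUpperGraph ha hE hne huniv
  exact ⟨T, hT, fun T' hT' => hT'.unique hT⟩
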